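/- For a group $G$ let $\gamma_1(G)=G$, $\gamma_{i+1}(G)=[\gamma_i(G),G]$ be its lower central series, and let $\widehat G=\varprojlim_i G/\gamma_i(G)$ be its pronilpotent completion. Write $H_2(G)=H_2(G,\mathbb Z)$ for the second homology with trivial integral coefficients. An abelian group $A$ is called cotorsion if $\mathrm{Ext}^1_{\mathbb Z}(\mathbb Q,A)=0$. Let $C=\langle t\rangle$ be an infinite cyclic group and let $L=\mathbb Z\wr\mathbb Z=C\ltimes\mathbb Z[t,t^{-1}]$ be the integral lamplighter group, where $t$ acts on $\mathbb Z[t,t^{-1}]$ by multiplication. Then the cokernel of the homomorphism $$H_2(L)\longrightarrow H_2(\widehat L)$$ induced by the canonical map $L\to\widehat L$ is not a cotorsion group. -/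

import Mathlib

open CategoryTheory

noncomputable section

/-- The action of the infinite cyclic group `C = ⟨t⟩` (written as `Multiplicative ℤ`) on the
additive group of `ℤ[t, t⁻¹]` (written as `Multiplicative ℤ[t, t⁻¹]`) by multiplication:
`t ^ n` acts as `p ↦ t ^ n * p`. -/
def lampAction :
    Multiplicative ℤ →* MulAut (Multiplicative (LaurentPolynomial ℤ)) where
  toFun n :=
    { toFun := fun p =>
        Multiplicative.ofAdd (LaurentPolynomial.T (Multiplicative.toAdd n) * p.toAdd)
      invFun := fun p =>
        Multiplicative.ofAdd (LaurentPolynomial.T (-Multiplicative.toAdd n) * p.toAdd)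
      left_inv := fun p => by
        simp [← mul_assoc]
      right_inv := fun p => by
        simp [← mul_assoc]
      map_mul' := fun p q => by
        simp [mul_add] }
  map_one' := by
    ext p
    simp
  map_mul' m n := by
    refine MulEquiv.ext fun p => congrArg Multiplicative.ofAdd ?_
    change LaurentPolynomial.T (Multiplicative.toAdd m + Multiplicative.toAdd n) * p.toAdd =
      LaurentPolynomial.T (Multiplicative.toAdd m) *
        (LaurentPolynomial.T (Multiplicative.toAdd n) * p.toAdd)
    rw [LaurentPolynomial.T_add, mul_assoc]

/-- The integral lamplighter group `L = ℤ ≀ ℤ = C ⋉ ℤ[t, t⁻¹]`, the restricted wreath product: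
`ℤ[t, t⁻¹]` is the group ring `ℤ[C]`, i.e. the direct sum of copies of `ℤ` indexed by `C`, on which
`C` acts by translation of the indices. -/
abbrev Lamplighter : Type :=
  Multiplicative (LaurentPolynomial ℤ) ⋊[lampAction] Multiplicative ℤ

section Completion

variable (G : Type) [Group G]

/-- The pronilpotent completion `lim G / γ_i(G)` of a group `G`: the group of families of elements
of the quotients `G / γ_i(G)` that are compatible with the projections
`G / γ_j(G) → G / γ_i(G)`, `i ≤ j`.  (Mathlib's `lowerCentralSeries` starts with index `0`, so that
`(⊤ : Subgroup G).lowerCentralSeries i` is `γ_{i+1}(G)`.) -/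
def pronilpotentCompletion :
    Subgroup (∀ i : ℕ, G ⧸ (⊤ : Subgroup G).lowerCentralSeries i) where
  carrier := { x | ∀ (i j : ℕ) (h : i ≤ j),
    QuotientGroup.map ((⊤ : Subgroup G).lowerCentralSeries j)
      ((⊤ : Subgroup G).lowerCentralSeries i) (MonoidHom.id G)
      (Subgroup.lowerCentralSeries_antitone _ h) (x j) = x i }
  one_mem' := fun i j h => by simp
  mul_mem' := fun {x y} hx hy i j h => by simp [hx i j h, hy i j h]
  inv_mem' := fun {x} hx i j h => by simp [hx i j h]

/-- The canonical homomorphism from `G` to its pronilpotent completion. -/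
def toPronilpotentCompletion : G →* pronilpotentCompletion G where
  toFun g := ⟨fun i => (g : G ⧸ (⊤ : Subgroup G).lowerCentralSeries i), fun _ _ _ => rfl⟩
  map_one' := rfl
  map_mul' _ _ := rfl

end Completion

/-- The second integral homology group `H_2(G) = H_2(G, ℤ)`. -/
abbrev H2 (G : Type) [Group G] : ModuleCat.{0} ℤ :=
  groupHomology (Rep.trivial ℤ G ℤ) 2

/-- The map `H_2(G) → H_2(H)` induced by a group homomorphism `G → H`
(and by the identity of the trivial coefficients `ℤ`). -/
def H2map {G H : Type} [Group G] [Group H] (f : G →* H) : H2 G ⟶ H2 H :=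
  groupHomology.map (A := Rep.trivial ℤ G ℤ) (B := Rep.trivial ℤ H ℤ) f
    (Rep.ofHom ⟨LinearMap.id, fun _ => rfl⟩) 2

/-- An abelian group `A` is cotorsion if `Ext(ℚ, A) = Ext¹_ℤ(ℚ, A)` vanishes. -/
def IsCotorsion (A : ModuleCat.{0} ℤ) : Prop :=
  Subsingleton (Abelian.Ext.{0} (ModuleCat.of ℤ ℚ) A 1)

end

/-!
Write `L̂` for the pronilpotent completion of the lamplighter group `L`. Since `γ_{i+1}(L)` is the
subgroup `(t - 1) ^ i ℤ[t, t⁻¹]` for `i ≥ 1`, the group `L̂` is `ℤ⟦X⟧ ⋊ ⟨t⟩` with `t = 1 + X`.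
Only two consequences are used: every power series `f` gives an element `ofSeries f` of `L̂`, where
any two such elements commute, and reading off the power series is a crossed homomorphism
`toSeries` from `L̂` to `A⟦X⟧`, for every coefficient ring `A`.

If the cokernel of `H₂(L) → H₂(L̂)` were cotorsion, then every system of equations
`y n = a n + (n + 1) y (n + 1)` would be solvable in it (`IsCotorsion.exists_solution`), as follows
from the free resolution of `ℚ` with generators `1 / n!`. Take for `a n` the class of the
`2`-cycle `(g, h) - (h, g)`, where `g` and `h` come from the power series `f (2 n)` and
`f (2 n + 1)` of a sequence of lacunary series. Then `y 0` is congruent to `∑_{n < p} n! a n`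
modulo `p!`, and this is an element of "rank `p`" modulo each prime `p`; but `y 0` is represented
by one finite chain, which bounds its rank independently of `p`.

The rank is made precise as follows. Fix a prime `p` and let `K = 𝔽_p(X)`. As `1` and the lacunary
series are linearly independent over `K` (`linearIndependent_oneAndLacunary`), there are `K`-linear
functionals on `𝔽_p⸨X⸩` dual to the lacunary series and zero on `K`. Composed with `toSeries` they
are crossed homomorphisms `u k : L̂ → K` for the action of `t` by `1 + X`, and they vanish on `L`;
applying the endomorphism of `K` that inverts `1 + X`, one gets crossed homomorphisms `v l` for the
inverse action (`exists_dual_crossedHom`). The cup product of `u k` and `v l` is a `2`-cocycle with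
trivial coefficients that vanishes on `L`, so it defines a homomorphism from the cokernel to `K`
(`exists_hom_cokernel_of_cocycle`). On a chain supported on `r` pairs, these homomorphisms
form a matrix in `(k, l)` of rank at most `r` (`card_le_of_evalChains_cup_eq_diagonal`), while on
`y 0` the matrix with entries `(2 k, 2 l + 1)`, `k, l < p`, is diagonal with entries `k!`, which
are nonzero modulo `p`. So `p ≤ r` for every prime `p`, which is absurd.
-/

open LaurentPolynomial (T)
open scoped commutatorElement

/-! ### Cotorsion groups and telescoping equations -/

/-- The endomorphism `e n ↦ e n - (n + 1) • e (n + 1)` of the free abelian group on `ℕ`, whose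
cokernel is `ℚ`. -/
noncomputable def telescopeMap : (ℕ →₀ ℤ) →ₗ[ℤ] (ℕ →₀ ℤ) :=
  Finsupp.linearCombination ℤ fun n =>
    Finsupp.single n 1 - ((n : ℤ) + 1) • Finsupp.single (n + 1) 1

/-- The map `e n ↦ 1 / n!` from the free abelian group on `ℕ` to `ℚ`. -/
noncomputable def invFactorialMap : (ℕ →₀ ℤ) →ₗ[ℤ] ℚ :=
  Finsupp.linearCombination ℤ fun n => (n.factorial : ℚ)⁻¹

lemma invFactorialMap_comp_telescopeMap : invFactorialMap ∘ₗ telescopeMap = 0 := by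
  ext n
  have h : (n.factorial : ℚ) ≠ 0 := by positivity
  have h' : (n : ℚ) + 1 ≠ 0 := by positivity
  simp [invFactorialMap, telescopeMap, Nat.factorial_succ]
  field_simp
  simp

lemma telescopeMap_apply_zero (v : ℕ →₀ ℤ) : telescopeMap v 0 = v 0 := by
  induction v using Finsupp.induction_linear with
  | zero => simp
  | add f g hf hg => simp [hf, hg]
  | single n a => simp [telescopeMap, Finsupp.single_apply]

lemma telescopeMap_apply_succ (v : ℕ →₀ ℤ) (n : ℕ) :
    telescopeMap v (n + 1) = v (n + 1) - (n + 1) * v n := by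
  induction v using Finsupp.induction_linear with
  | zero => simp
  | add f g hf hg => simp [hf, hg]; ring
  | single m a =>
    by_cases h : m = n
    · subst h
      simp [telescopeMap]
      ring
    · simp [telescopeMap, Finsupp.single_apply, h]

lemma telescopeMap_injective : Function.Injective telescopeMap := by
  rw [injective_iff_map_eq_zero]
  intro v hv
  ext n
  induction n with
  | zero => simpa [hv] using (telescopeMap_apply_zero v).symm
  | succ n ih =>
    have := telescopeMap_apply_succ v n
    simp_all

/-- Modulo the image of `telescopeMap`, every element is a multiple of a single basis vector
`e N`, as `e n` is a multiple of `e N` for `n ≤ N`. -/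
lemma exists_sub_single_mem_range_telescopeMap (v : ℕ →₀ ℤ) :
    ∃ N₀ : ℕ, ∀ N ≥ N₀, ∃ c : ℤ, v - Finsupp.single N c ∈ LinearMap.range telescopeMap := by
  induction v using Finsupp.induction_linear with
  | zero => exact ⟨0, fun N _ => ⟨0, by simp⟩⟩
  | add f g hf hg =>
    obtain ⟨N₁, h₁⟩ := hf
    obtain ⟨N₂, h₂⟩ := hg
    refine ⟨max N₁ N₂, fun N hN => ?_⟩
    obtain ⟨c, hc⟩ := h₁ N (le_trans (le_max_left _ _) hN)
    obtain ⟨d, hd⟩ := h₂ N (le_trans (le_max_right _ _) hN)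
    refine ⟨c + d, ?_⟩
    rw [Finsupp.single_add, add_sub_add_comm]
    exact add_mem hc hd
  | single n a =>
    refine ⟨n, fun N hN => ?_⟩
    induction N, hN using Nat.le_induction with
    | base => exact ⟨a, by simp⟩
    | succ N _ ih =>
      obtain ⟨c, hc⟩ := ih
      refine ⟨c * (N + 1), ?_⟩
      have h : Finsupp.single n a - Finsupp.single (N + 1) (c * ((N : ℤ) + 1)) =
          (Finsupp.single n a - Finsupp.single N c) + telescopeMap (Finsupp.single N c) := by
        rw [telescopeMap, Finsupp.linearCombination_single, smul_sub, smul_smul]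
        simp only [Finsupp.smul_single, smul_eq_mul, mul_one, sub_add_sub_cancel]
      rw [h]
      exact add_mem hc ⟨_, rfl⟩

lemma exact_telescopeMap_invFactorialMap : Function.Exact telescopeMap invFactorialMap := by
  intro v
  constructor
  · intro hv
    obtain ⟨N, hN⟩ := exists_sub_single_mem_range_telescopeMap v
    obtain ⟨c, w, hw⟩ := hN N le_rfl
    have h0 : invFactorialMap (telescopeMap w) = 0 :=
      LinearMap.congr_fun invFactorialMap_comp_telescopeMap w
    have hc : c = 0 := by
      rw [hw, map_sub, hv] at h0
      simpa [invFactorialMap, Nat.factorial_ne_zero] using h0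
    exact ⟨w, by simpa [hc] using hw⟩
  · rintro ⟨w, rfl⟩
    exact LinearMap.congr_fun invFactorialMap_comp_telescopeMap w

lemma invFactorialMap_surjective : Function.Surjective invFactorialMap := by
  intro q
  refine ⟨Finsupp.single q.den (q.num * (q.den - 1).factorial), ?_⟩
  have h : q.den.factorial = q.den * (q.den - 1).factorial :=
    (Nat.mul_factorial_pred q.den_ne_zero).symm
  have h1 : ((q.den - 1).factorial : ℚ) ≠ 0 := by positivity
  have h2 : (q.den : ℚ) ≠ 0 := by simp
  rw [invFactorialMap, Finsupp.linearCombination_single, h, zsmul_eq_mul]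
  push_cast
  rw [mul_inv, mul_mul_mul_comm, mul_inv_cancel₀ h1, mul_one, ← div_eq_mul_inv, Rat.num_div_den]

/-- The free resolution `0 → ℤ^(ℕ) → ℤ^(ℕ) → ℚ → 0` given by `telescopeMap` and
`invFactorialMap`, as a short complex. -/
noncomputable abbrev ratResolution : ShortComplex (ModuleCat.{0} ℤ) :=
  ShortComplex.mk (ModuleCat.ofHom telescopeMap) (ModuleCat.ofHom invFactorialMap) (by
    rw [← ModuleCat.ofHom_comp, invFactorialMap_comp_telescopeMap]; rfl)

lemma ratResolution_shortExact : ratResolution.ShortExact where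
  exact := (ShortComplex.ShortExact.moduleCat_exact_iff_function_exact _).2
    exact_telescopeMap_invFactorialMap
  mono_f := (ModuleCat.mono_iff_injective _).2 telescopeMap_injective
  epi_g := (ModuleCat.epi_iff_surjective _).2 invFactorialMap_surjective

/-- In a cotorsion group every system of equations `y n - (n + 1) y (n + 1) = a n` is solvable:
a solution is an extension along `telescopeMap` of the homomorphism `e n ↦ a n`. -/
theorem IsCotorsion.exists_solution {A : ModuleCat.{0} ℤ} (hA : IsCotorsion A) (a : ℕ → A) :
    ∃ y : ℕ → A, ∀ n, y n = a n + ((n : ℤ) + 1) • y (n + 1) := by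
  have hA' : Subsingleton (Abelian.Ext.{0} ratResolution.X₃ A 1) := hA
  let α : ratResolution.X₁ ⟶ A := ModuleCat.ofHom (Finsupp.linearCombination ℤ a)
  obtain ⟨x, hx⟩ := Abelian.Ext.contravariant_sequence_exact₁ ratResolution_shortExact
    A (Abelian.Ext.mk₀ α) (n₁ := 1) rfl (Subsingleton.elim _ _)
  obtain ⟨β, rfl⟩ := (Abelian.Ext.mk₀_bijective _ _).2 x
  rw [Abelian.Ext.mk₀_comp_mk₀] at hx
  have hβ := (Abelian.Ext.mk₀_bijective _ _).1 hx
  refine ⟨fun n => β (Finsupp.single n 1), fun n => ?_⟩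
  have h : β (telescopeMap (Finsupp.single n 1)) = a n :=
    congr($(hβ) (Finsupp.single n 1)).trans
      ((Finsupp.linearCombination_single ℤ 1 n).trans (A.isModule.one_smul _))
  have h' : telescopeMap (Finsupp.single n 1) =
      Finsupp.single n 1 - ((n : ℤ) + 1) • Finsupp.single (n + 1) 1 := by
    rw [telescopeMap, Finsupp.linearCombination_single, one_smul]
  rw [h', map_sub, map_zsmul] at h
  exact eq_add_of_sub_eq h

/-- Iterating `y n = a n + (n + 1) y (n + 1)` expands `y 0` as `∑_{n < N} n! a n`, with remainder
`N! y N`. -/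
lemma eq_sum_factorial_smul_add {M : Type*} [AddCommGroup M] {a y : ℕ → M}
    (h : ∀ n, y n = a n + ((n : ℤ) + 1) • y (n + 1)) (N : ℕ) :
    y 0 = ∑ n ∈ Finset.range N, (n.factorial : ℤ) • a n + (N.factorial : ℤ) • y N := by
  induction N with
  | zero => simp
  | succ N ih =>
    rw [ih, Finset.sum_range_succ, h N, smul_add, smul_smul, Nat.factorial_succ, add_assoc]
    push_cast
    rw [mul_comm]

/-! ### Second homology and `2`-cocycles -/

section

variable {G : Type} [Group G] {K : Type} [AddCommGroup K]

/-- Evaluation of integral inhomogeneous `2`-chains of a group on a function `β : G × G → K`. -/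
noncomputable def evalChains (β : G × G → K) : (G × G →₀ ℤ) →ₗ[ℤ] K :=
  Finsupp.linearCombination ℤ β

/-- The inhomogeneous `2`-cocycle condition, for trivial coefficients. -/
def IsTrivialCocycle₂ (β : G × G → K) : Prop :=
  ∀ g h j : G, β (h, j) - β (g * h, j) + β (g, h * j) - β (g, h) = 0

lemma evalChains_eq_zero_of_mem_boundaries₂ {β : G × G → K} (hβ : IsTrivialCocycle₂ β)
    {x : G × G →₀ ℤ} (hx : x ∈ groupHomology.boundaries₂ (Rep.trivial ℤ G ℤ)) :
    evalChains β x = 0 := by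
  obtain ⟨w, rfl⟩ := hx
  have h : evalChains β ∘ₗ (groupHomology.d₃₂ (Rep.trivial ℤ G ℤ)).hom = 0 := by
    refine Finsupp.lhom_ext fun g a => ?_
    have h1 := groupHomology.d₃₂_single (A := Rep.trivial ℤ G ℤ) g a
    have h2 : evalChains β (groupHomology.d₃₂ (Rep.trivial ℤ G ℤ) (Finsupp.single g a)) = 0 := by
      rw [h1]
      have := congr(a • $(hβ g.1 g.2.1 g.2.2))
      simpa [evalChains, smul_sub, smul_add] using this
    exact h2
  exact LinearMap.congr_fun h w

/-- A `2`-cocycle with values in `K` defines a homomorphism `H₂(G) → K`. -/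
lemma exists_hom_H2_of_cocycle {β : G × G → K} (hβ : IsTrivialCocycle₂ β) :
    ∃ F : H2 G →ₗ[ℤ] K, ∀ x : groupHomology.cycles₂ (Rep.trivial ℤ G ℤ),
      F (groupHomology.H2π (Rep.trivial ℤ G ℤ) x) = evalChains β x.1 := by
  let q := (groupHomology.H2π (Rep.trivial ℤ G ℤ)).hom
  have hq : Function.Surjective q := (ModuleCat.epi_iff_surjective _).1 inferInstance
  let e : groupHomology.cycles₂ (Rep.trivial ℤ G ℤ) →ₗ[ℤ] K :=
    evalChains β ∘ₗ (groupHomology.cycles₂ (Rep.trivial ℤ G ℤ)).subtype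
  have he : LinearMap.ker q ≤ LinearMap.ker e := fun x hx =>
    evalChains_eq_zero_of_mem_boundaries₂ hβ ((groupHomology.H2π_eq_zero_iff x).1 hx)
  refine ⟨(LinearMap.ker q).liftQ e he ∘ₗ (q.quotKerEquivOfSurjective hq).symm.toLinearMap,
    fun x => ?_⟩
  have : (q.quotKerEquivOfSurjective hq).symm (q x) = (LinearMap.ker q).mkQ x := by
    rw [LinearEquiv.symm_apply_eq]; rfl
  change (LinearMap.ker q).liftQ e he ((q.quotKerEquivOfSurjective hq).symm (q x)) = _
  rw [this]
  rfl

/-- A `2`-cocycle on `H` that vanishes on the image of `f : G → H` defines a homomorphism from the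
cokernel of `H₂(G) → H₂(H)`. -/
lemma exists_hom_cokernel_of_cocycle {H : Type} [Group H] (f : G →* H) {β : H × H → K}
    (hβ : IsTrivialCocycle₂ β) (hf : ∀ g h : G, β (f g, f h) = 0) :
    ∃ F : (Limits.cokernel (H2map f) : ModuleCat.{0} ℤ) →ₗ[ℤ] K,
      ∀ x : groupHomology.cycles₂ (Rep.trivial ℤ H ℤ),
        F (Limits.cokernel.π (H2map f) (groupHomology.H2π (Rep.trivial ℤ H ℤ) x)) =
          evalChains β x.1 := by
  obtain ⟨F, hF⟩ := exists_hom_H2_of_cocycle hβ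
  have h0 : H2map f ≫ ModuleCat.ofHom F = 0 := by
    ext z
    induction z using groupHomology.H2_induction_on with | h x => ?_
    have h1 : H2map f (groupHomology.H2π (Rep.trivial ℤ G ℤ) x) =
        groupHomology.H2π (Rep.trivial ℤ H ℤ) (groupHomology.mapCycles₂
          (A := Rep.trivial ℤ G ℤ) (B := Rep.trivial ℤ H ℤ) f
          (Rep.ofHom ⟨LinearMap.id, fun _ => rfl⟩) x) :=
      congr($(groupHomology.H2π_comp_map (A := Rep.trivial ℤ G ℤ) (B := Rep.trivial ℤ H ℤ) f
          (Rep.ofHom ⟨LinearMap.id, fun _ => rfl⟩)) x)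
    change F (H2map f (groupHomology.H2π (Rep.trivial ℤ G ℤ) x)) = 0
    rw [h1, hF, groupHomology.coe_mapCycles₂]
    have h2 : evalChains β ∘ₗ (groupHomology.chainsMap₂
          (A := Rep.trivial ℤ G ℤ) (B := Rep.trivial ℤ H ℤ) f
          (Rep.ofHom ⟨LinearMap.id, fun _ => rfl⟩)).hom = 0 := by
      refine Finsupp.lhom_ext fun g a => ?_
      simp [evalChains, groupHomology.chainsMap₂, Prod.map, hf]
    exact LinearMap.congr_fun h2 x.1
  refine ⟨(Limits.cokernel.desc (H2map f) (ModuleCat.ofHom F) h0).hom, fun x => ?_⟩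
  rw [← hF]
  exact congr($(Limits.cokernel.π_desc (H2map f) (ModuleCat.ofHom F) h0)
    (groupHomology.H2π (Rep.trivial ℤ H ℤ) x))

/-- Every element of the cokernel of `H₂(G) → H₂(H)` is represented by a `2`-cycle of `H`. -/
lemma exists_cycle_of_cokernel {H : Type} [Group H] (f : G →* H)
    (y : (Limits.cokernel (H2map f) : ModuleCat.{0} ℤ)) :
    ∃ x : groupHomology.cycles₂ (Rep.trivial ℤ H ℤ),
      Limits.cokernel.π (H2map f) (groupHomology.H2π (Rep.trivial ℤ H ℤ) x) = y := by
  obtain ⟨z, rfl⟩ := (ModuleCat.epi_iff_surjective (Limits.cokernel.π (H2map f))).1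
    inferInstance y
  induction z using groupHomology.H2_induction_on with | h x => exact ⟨x, rfl⟩

/-- For commuting elements `g`, `h`, the chain `(g, h) - (h, g)` is a `2`-cycle. -/
lemma single_sub_single_mem_cycles₂ {g h : G} (hgh : Commute g h) :
    (Finsupp.single (g, h) 1 - Finsupp.single (h, g) 1 : G × G →₀ ℤ) ∈
      groupHomology.cycles₂ (Rep.trivial ℤ G ℤ) := by
  have h1 := groupHomology.d₂₁_single (A := Rep.trivial ℤ G ℤ) (g, h) (1 : ℤ)
  have h2 := groupHomology.d₂₁_single (A := Rep.trivial ℤ G ℤ) (h, g) (1 : ℤ)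
  change (groupHomology.d₂₁ (Rep.trivial ℤ G ℤ)).hom _ = 0
  rw [map_sub]
  erw [h1, h2]
  simp [hgh.eq]
  abel

end

/-- If `u : G → K` is a crossed homomorphism for the action of `G` on the field `K` through a
character `χ`, and `v` is one for the action through `χ⁻¹`, then their cup product is a
`2`-cocycle with trivial coefficients. -/
lemma isTrivialCocycle₂_cup {G K : Type} [Group G] [Field K] (χ : G →* Kˣ) {u v : G → K}
    (hu : ∀ g h, u (g * h) = u g + χ g * u h)
    (hv : ∀ g h, v (g * h) = v g + (χ g)⁻¹ * v h) :
    IsTrivialCocycle₂ fun x : G × G => u x.1 * ((χ x.1)⁻¹ * v x.2) := by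
  intro g h j
  have h1 : (χ g : K) ≠ 0 := (χ g).ne_zero
  have h2 : (χ h : K) ≠ 0 := (χ h).ne_zero
  simp only [hu, hv, map_mul, mul_inv, Units.val_mul, Units.val_inv_eq_inv_val]
  field_simp
  ring

/-! ### The pronilpotent completion of the lamplighter group -/

section

variable (A : Type) [CommRing A]

lemma isUnit_one_add_X : IsUnit (1 + PowerSeries.X : PowerSeries A) := by
  rw [PowerSeries.isUnit_iff_constantCoeff]
  simp

/-- The ring homomorphism `ℤ[t, t⁻¹] → A⟦X⟧` that sends `t` to `1 + X`. -/
noncomputable def laurentExpansion : LaurentPolynomial ℤ →+* PowerSeries A :=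
  LaurentPolynomial.eval₂ (Int.castRingHom _) (isUnit_one_add_X A).unit

lemma laurentExpansion_T_one : laurentExpansion A (T 1) = 1 + PowerSeries.X := by
  simp [laurentExpansion]

lemma X_dvd_laurentExpansion_T_sub_one (n : ℤ) :
    PowerSeries.X ∣ laurentExpansion A (T n) - 1 := by
  rw [PowerSeries.X_dvd_iff, laurentExpansion, LaurentPolynomial.eval₂_T, map_sub]
  have : Units.map (PowerSeries.constantCoeff (R := A)).toMonoidHom
      ((isUnit_one_add_X A).unit ^ n) = 1 := by
    rw [map_zpow]
    have h : Units.map (PowerSeries.constantCoeff (R := A)).toMonoidHom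
      (isUnit_one_add_X A).unit = 1 := by
        ext; simp
    rw [h, one_zpow]
  have h2 := congrArg Units.val this
  simp only [Units.coe_map] at h2
  simpa [sub_eq_zero] using h2

lemma Lamplighter.left_mul (g h : Lamplighter) :
    (g * h).left.toAdd = g.left.toAdd + T g.right.toAdd * h.left.toAdd := rfl

/-- Elements of the `i`-th term of the lower central series of the lamplighter group lie in
`ℤ[t, t⁻¹]` (unless `i = 0`) and are divisible by `(t - 1) ^ i` there, at least after expansion
in powers of `t - 1`. -/
lemma Lamplighter.of_mem_lowerCentralSeries (i : ℕ) :
    ∀ g ∈ (⊤ : Subgroup Lamplighter).lowerCentralSeries i,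
      (i ≠ 0 → g.right = 1) ∧ PowerSeries.X ^ i ∣ laurentExpansion A g.left.toAdd := by
  induction i with
  | zero => simp
  | succ i ih =>
    intro g hg
    rw [Subgroup.lowerCentralSeries_succ] at hg
    suffices h : g.right = 1 ∧ PowerSeries.X ^ (i + 1) ∣ laurentExpansion A g.left.toAdd from
      ⟨fun _ => h.1, h.2⟩
    induction hg using Subgroup.closure_induction with
    | mem c hc =>
      obtain ⟨g, hg, h, -, rfl⟩ := hc
      obtain ⟨h1, h2⟩ := ih g hg
      have hr : ⁅g, h⁆.right = 1 := by
        simp [commutatorElement_def]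
      refine ⟨hr, ?_⟩
      have e : (⁅g, h⁆ * (h * g)).left.toAdd = (g * h).left.toAdd := by
        congr 2; simp [commutatorElement_def, mul_assoc]
      rw [left_mul, left_mul, left_mul, hr, toAdd_one, LaurentPolynomial.T_zero, one_mul,
        ← eq_sub_iff_add_eq] at e
      have e' : laurentExpansion A ⁅g, h⁆.left.toAdd =
          (laurentExpansion A (T g.right.toAdd) - 1) * laurentExpansion A h.left.toAdd -
          (laurentExpansion A (T h.right.toAdd) - 1) * laurentExpansion A g.left.toAdd := by
        rw [e]; simp only [map_add, map_sub, map_mul]; ring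
      rw [e']
      refine dvd_sub ?_ ?_
      · obtain rfl | hi := eq_or_ne i 0
        · simpa using (X_dvd_laurentExpansion_T_sub_one A _).mul_right _
        · simp [h1 hi]
      · rw [pow_succ']
        exact mul_dvd_mul (X_dvd_laurentExpansion_T_sub_one A _) h2
    | one => simp
    | mul a b _ _ ha hb =>
      refine ⟨by simp [ha.1, hb.1], ?_⟩
      rw [left_mul, ha.1, map_add]
      exact dvd_add ha.2 (by simpa using hb.2)
    | inv a _ ha =>
      refine ⟨by simp [ha.1], ?_⟩
      have h := left_mul a⁻¹ a
      rw [inv_mul_cancel, SemidirectProduct.inv_right, ha.1] at h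
      simp only [SemidirectProduct.one_left, toAdd_one, inv_one, LaurentPolynomial.T_zero,
        one_mul] at h
      rw [eq_neg_of_add_eq_zero_left h.symm, map_neg, dvd_neg]
      exact ha.2

end

/-- `ℤ[t, t⁻¹]` as a subgroup of the lamplighter group. -/
noncomputable def Lamplighter.ofLaurent (q : LaurentPolynomial ℤ) : Lamplighter :=
  SemidirectProduct.inl (Multiplicative.ofAdd q)

lemma Lamplighter.ofLaurent_add (q r : LaurentPolynomial ℤ) :
    ofLaurent (q + r) = ofLaurent q * ofLaurent r := by
  simp [ofLaurent]

/-- The element `(t - 1) ^ i q` of `ℤ[t, t⁻¹]` is, up to sign, an `i`-fold commutator of `q` with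
`t`. -/
lemma Lamplighter.ofLaurent_mem_lowerCentralSeries (i : ℕ) :
    ∀ q : LaurentPolynomial ℤ,
      ofLaurent ((T 1 - 1) ^ i * q) ∈ (⊤ : Subgroup Lamplighter).lowerCentralSeries i := by
  induction i with
  | zero => simp
  | succ i ih =>
    intro q
    rw [Subgroup.lowerCentralSeries_succ]
    have h : ofLaurent ((T 1 - 1) ^ (i + 1) * q) =
        ⁅ofLaurent ((T 1 - 1) ^ i * -q), SemidirectProduct.inr (Multiplicative.ofAdd 1)⁆ := by
      rw [commutatorElement_def, eq_mul_inv_iff_mul_eq, eq_mul_inv_iff_mul_eq]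
      refine SemidirectProduct.ext (Multiplicative.toAdd.injective ?_) (by simp [ofLaurent])
      simp only [left_mul, ofLaurent, SemidirectProduct.mul_right, SemidirectProduct.left_inl,
        SemidirectProduct.right_inl, SemidirectProduct.left_inr, SemidirectProduct.right_inr,
        toAdd_ofAdd, toAdd_one, LaurentPolynomial.T_zero, one_mul]
      ring
    rw [h]
    exact Subgroup.commutator_mem_commutator (ih _) (Subgroup.mem_top _)

/-- The pronilpotent completion of the lamplighter group. -/
abbrev CompletedLamplighter : Type := pronilpotentCompletion Lamplighter

namespace CompletedLamplighter

/-- The element of the pronilpotent completion given by a power series `f` in `t - 1`: its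
components are the classes of the truncations of `f`. -/
noncomputable def ofSeries (f : PowerSeries ℤ) : CompletedLamplighter :=
  ⟨fun i => (Lamplighter.ofLaurent (Polynomial.aeval (T 1 - 1) (f.trunc i)) : Lamplighter),
    fun i j hij => by
      refine QuotientGroup.eq.2 ?_
      have hd : (Polynomial.X : Polynomial ℤ) ^ i ∣ f.trunc i - f.trunc j := by
        rw [Polynomial.X_pow_dvd_iff]
        intro d hd
        simp [PowerSeries.coeff_trunc, hd, hd.trans_le hij]
      obtain ⟨w, hw⟩ := hd
      have h := Lamplighter.ofLaurent_mem_lowerCentralSeries i (Polynomial.aeval (T 1 - 1) w)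
      have e : (Polynomial.aeval (T 1 - 1) (f.trunc i) : LaurentPolynomial ℤ) =
          Polynomial.aeval (T 1 - 1) (f.trunc j) +
            (T 1 - 1) ^ i * Polynomial.aeval (T 1 - 1) w := by
        rw [← sub_eq_iff_eq_add', ← map_sub, hw]
        simp
      rw [e, Lamplighter.ofLaurent_add, MonoidHom.id_apply, inv_mul_cancel_left]
      exact h⟩

lemma commute_ofSeries (f f' : PowerSeries ℤ) : Commute (ofSeries f) (ofSeries f') := by
  refine Subtype.ext (funext fun i => ?_)
  refine congrArg (QuotientGroup.mk (s := (⊤ : Subgroup Lamplighter).lowerCentralSeries i))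
    (?_ : Lamplighter.ofLaurent _ * Lamplighter.ofLaurent _ =
      Lamplighter.ofLaurent _ * Lamplighter.ofLaurent _)
  rw [← Lamplighter.ofLaurent_add, add_comm, Lamplighter.ofLaurent_add]

/-- The projection `L ⧸ [L, L] → ⟨t⟩`. -/
noncomputable def abelianizedShift :
    Lamplighter ⧸ (⊤ : Subgroup Lamplighter).lowerCentralSeries 1 →* Multiplicative ℤ :=
  QuotientGroup.lift _ SemidirectProduct.rightHom
    fun g hg => (Lamplighter.of_mem_lowerCentralSeries ℤ 1 g hg).1 one_ne_zero

/-- The projection of the pronilpotent completion onto the infinite cyclic group `⟨t⟩`. -/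
noncomputable def shift : CompletedLamplighter →* Multiplicative ℤ :=
  abelianizedShift.comp
    ((Pi.evalMonoidHom _ 1).comp (pronilpotentCompletion Lamplighter).subtype)

lemma component_eq_of_le {g : CompletedLamplighter} {i j : ℕ} (hij : i ≤ j) {l : Lamplighter}
    (hl : g.1 j = l) : g.1 i = l := by
  rw [← g.2 i j hij, hl]; rfl

lemma shift_eq {g : CompletedLamplighter} {i : ℕ} (hi : i ≠ 0) {l : Lamplighter}
    (hl : g.1 i = l) : shift g = l.right := by
  exact congrArg abelianizedShift (component_eq_of_le (Nat.one_le_iff_ne_zero.2 hi) hl)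

variable (A : Type) [CommRing A]

/-- The underlying function of the crossed homomorphism from the pronilpotent completion
to `A⟦X⟧` (on which `t` acts as `1 + X`) which extends the inclusion of `ℤ[t, t⁻¹]`. The
coefficient of `X ^ k` is read off from a representative of the component in
`L ⧸ γ_{k + 2}(L)`. -/
noncomputable def toSeries (g : CompletedLamplighter) : PowerSeries A :=
  PowerSeries.mk fun k =>
    PowerSeries.coeff k (laurentExpansion A (Quotient.out (g.1 (k + 1))).left.toAdd)

lemma coeff_toSeries {g : CompletedLamplighter} {k i : ℕ} (hk : k < i) {l : Lamplighter}
    (hl : g.1 i = l) :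
    PowerSeries.coeff k (toSeries A g) = PowerSeries.coeff k (laurentExpansion A l.left.toAdd) := by
  have h : ((Quotient.out (g.1 (k + 1)) : Lamplighter) :
      Lamplighter ⧸ (⊤ : Subgroup Lamplighter).lowerCentralSeries (k + 1)) = l :=
    (QuotientGroup.out_eq' _).trans (component_eq_of_le hk hl)
  rw [toSeries, PowerSeries.coeff_mk]
  generalize (Quotient.out (g.1 (k + 1)) : Lamplighter) = l' at h ⊢
  rw [QuotientGroup.eq] at h
  obtain ⟨-, hd⟩ := Lamplighter.of_mem_lowerCentralSeries A _ _ h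
  have e := Lamplighter.left_mul l' (l'⁻¹ * l)
  rw [mul_inv_cancel_left] at e
  rw [e, map_add, map_mul, map_add,
    PowerSeries.X_pow_dvd_iff.1 (hd.mul_left _) k (Nat.lt_succ_self k), add_zero]

lemma toSeries_mul (g h : CompletedLamplighter) :
    toSeries A (g * h) =
      toSeries A g + laurentExpansion A (T (shift g).toAdd) * toSeries A h := by
  ext k
  obtain ⟨a, ha⟩ := QuotientGroup.mk_surjective (g.1 (k + 1))
  obtain ⟨b, hb⟩ := QuotientGroup.mk_surjective (h.1 (k + 1))
  have hab : (g * h).1 (k + 1) = ((a * b : Lamplighter) : Lamplighter ⧸ _) := by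
    rw [QuotientGroup.mk_mul, ha, hb]; rfl
  rw [coeff_toSeries A (Nat.lt_succ_self k) hab, shift_eq (Nat.succ_ne_zero k) ha.symm,
    Lamplighter.left_mul, map_add, map_mul, map_add, map_add,
    coeff_toSeries A (Nat.lt_succ_self k) ha.symm, PowerSeries.coeff_mul, PowerSeries.coeff_mul]
  congr 1
  refine Finset.sum_congr rfl fun x hx => ?_
  have hx' : x.2 ≤ k := Finset.HasAntidiagonal.mem_antidiagonal.1 hx ▸ Nat.le_add_left _ _
  rw [coeff_toSeries A (Nat.lt_succ_of_le hx') hb.symm]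

lemma toSeries_toPronilpotentCompletion (l : Lamplighter) :
    toSeries A (toPronilpotentCompletion Lamplighter l) = laurentExpansion A l.left.toAdd :=
  PowerSeries.ext fun k => coeff_toSeries A (Nat.lt_succ_self k) rfl

lemma laurentExpansion_aeval (q : Polynomial ℤ) :
    laurentExpansion A (Polynomial.aeval (T 1 - 1) q) = q.map (Int.castRingHom A) := by
  induction q using Polynomial.induction_on' with
  | add p q hp hq => simp [hp, hq]
  | monomial n a =>
    rw [Polynomial.aeval_monomial, map_mul, map_pow, map_sub, laurentExpansion_T_one, map_one,
      add_sub_cancel_left, Polynomial.map_monomial, ← Polynomial.C_mul_X_pow_eq_monomial]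
    simp only [map_intCast, Polynomial.coe_mul, Polynomial.coe_pow, Polynomial.coe_X, eq_intCast]
    congr 1
    exact (map_intCast (Polynomial.coeToPowerSeries.ringHom (R := A)) a).symm

lemma toSeries_ofSeries (f : PowerSeries ℤ) :
    toSeries A (ofSeries f) = f.map (Int.castRingHom A) := by
  ext k
  rw [coeff_toSeries A (Nat.lt_succ_self k) (l := Lamplighter.ofLaurent _) rfl]
  simp [Lamplighter.ofLaurent, laurentExpansion_aeval, PowerSeries.coeff_trunc]

lemma shift_ofSeries (f : PowerSeries ℤ) : shift (ofSeries f) = 1 := rfl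

end CompletedLamplighter

/-! ### Lacunary power series and their dual functionals -/

open scoped Classical in
/-- A family of lacunary power series: `lacunarySeries n` is the sum of the `X ^ (2 ^ m)` over the
infinitely many `m` whose first coordinate under the pairing `ℕ ≃ ℕ × ℕ` is `n`. -/
noncomputable def lacunarySeries (n : ℕ) : PowerSeries ℤ :=
  PowerSeries.mk fun e => if ∃ m : ℕ, e = 2 ^ m ∧ m.unpair.1 = n then 1 else 0

section

variable (F : Type) [Field F]

/-- The constant series `1`, indexed by `none`, together with the lacunary series, over the
field `F`. -/
noncomputable def oneAndLacunary : Option ℕ → PowerSeries F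
  | none => 1
  | some n => (lacunarySeries n).map (Int.castRingHom F)

/-- Within distance `d` of the exponent `2 ^ m`, where `2 * d < 2 ^ m`, no series of the family
`oneAndLacunary` has a nonzero coefficient, except that of `X ^ (2 ^ m)` in the series to which
this exponent belongs. -/
lemma coeff_oneAndLacunary {d m e : ℕ} (hm : 2 * d < 2 ^ m) (h₁ : e ≤ 2 ^ m + d)
    (h₂ : 2 ^ m ≤ e + d) (o : Option ℕ) :
    PowerSeries.coeff e (oneAndLacunary F o) =
      if e = 2 ^ m ∧ o = some m.unpair.1 then 1 else 0 := by
  cases o with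
  | none =>
    have : e ≠ 0 := by omega
    simp [oneAndLacunary, PowerSeries.coeff_one, this]
  | some n =>
    have key : (∃ m' : ℕ, e = 2 ^ m' ∧ m'.unpair.1 = n) ↔
        e = 2 ^ m ∧ some n = some m.unpair.1 := by
      constructor
      · rintro ⟨m', rfl, hn⟩
        have : m' = m := by
          rcases lt_trichotomy m' m with h | h | h
          · have : 2 ^ (m' + 1) ≤ 2 ^ m := Nat.pow_le_pow_right two_pos h
            rw [pow_succ] at this
            omega
          · exact h
          · have : 2 ^ (m + 1) ≤ 2 ^ m' := Nat.pow_le_pow_right two_pos h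
            rw [pow_succ] at this
            omega
        subst this
        exact ⟨rfl, by rw [hn]⟩
      · rintro ⟨rfl, h⟩
        exact ⟨m, rfl, (Option.some.inj h).symm⟩
    simp only [oneAndLacunary, lacunarySeries, PowerSeries.coeff_map, PowerSeries.coeff_mk, key]
    split_ifs <;> simp

/-- No nontrivial polynomial relation holds between `1` and the lacunary series. -/
lemma eq_zero_of_sum_mul_oneAndLacunary (s : Finset (Option ℕ)) (q : Option ℕ → Polynomial F)
    (h : ∑ o ∈ s, (q o : PowerSeries F) * oneAndLacunary F o = 0) :
    ∀ n : ℕ, some n ∈ s → q (some n) = 0 := by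
  intro n hn
  ext i
  -- The coefficient of `X ^ (i + 2 ^ m)` in the relation is the coefficient of `X ^ i` in
  -- `q (some n)`, if the exponent `2 ^ m` belongs to the series `n` and is large compared with
  -- the degrees of the polynomials.
  set d := s.sup (fun o => (q o).natDegree) + i
  have hdeg : ∀ o ∈ s, (q o).natDegree ≤ d := fun o ho =>
    (Finset.le_sup (f := fun o => (q o).natDegree) ho).trans (Nat.le_add_right _ _)
  obtain ⟨m, hm, hmn⟩ : ∃ m : ℕ, 2 * d < 2 ^ m ∧ m.unpair.1 = n := by
    refine ⟨Nat.pair n (2 * d), ?_, by simp⟩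
    exact Nat.lt_two_pow_self.trans_le
      (Nat.pow_le_pow_right two_pos (Nat.right_le_pair n (2 * d)))
  have hi : i ≤ d := Nat.le_add_left _ _
  have hterm : ∀ o ∈ s, PowerSeries.coeff (i + 2 ^ m) ((q o : PowerSeries F) *
      oneAndLacunary F o) = if o = some n then (q o).coeff i else 0 := by
    intro o ho
    rw [PowerSeries.coeff_mul, Finset.sum_eq_single (i, 2 ^ m)]
    · rw [coeff_oneAndLacunary F hm (by omega) (by omega)]
      simp [hmn]
    · rintro ⟨a, b⟩ hab hne
      rw [Finset.HasAntidiagonal.mem_antidiagonal] at hab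
      change a + b = i + 2 ^ m at hab
      rw [Polynomial.coeff_coe]
      by_cases ha : a ≤ d
      · rw [coeff_oneAndLacunary F hm (by omega) (by omega), if_neg, mul_zero]
        rintro ⟨hb, -⟩
        exact hne (Prod.ext (by change a = i; change b = 2 ^ m at hb; omega) hb)
      · rw [Polynomial.coeff_eq_zero_of_natDegree_lt ((hdeg o ho).trans_lt (not_le.1 ha)),
          zero_mul]
    · simp
  have := congrArg (PowerSeries.coeff (i + 2 ^ m)) h
  rw [map_sum, Finset.sum_congr rfl hterm, Finset.sum_ite_eq' s (some n), if_pos hn] at this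
  simpa using this

open scoped LaurentSeries RatFunc

lemma linearIndependent_oneAndLacunary :
    LinearIndependent (RatFunc F) fun o => (oneAndLacunary F o : F⸨X⸩) := by
  rw [← LinearIndependent.iff_fractionRing (Polynomial F), linearIndependent_iff']
  intro s q h
  have hcoe : ∀ p : Polynomial F, algebraMap (Polynomial F) F⸨X⸩ p = ((p : PowerSeries F) : F⸨X⸩) :=
    fun p => rfl
  have hs : ∑ o ∈ s, (q o : PowerSeries F) * oneAndLacunary F o = 0 := by
    apply HahnSeries.ofPowerSeries_injective (Γ := ℤ) (R := F)
    rw [map_sum, map_zero, ← h]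
    exact Finset.sum_congr rfl fun o _ => by rw [Algebra.smul_def, map_mul, hcoe]
  have hsome := eq_zero_of_sum_mul_oneAndLacunary F s q hs
  intro o ho
  cases o with
  | some n => exact hsome n ho
  | none =>
    rw [Finset.sum_eq_single none] at hs
    · simpa [oneAndLacunary] using hs
    · intro b hb hne
      obtain ⟨n, rfl⟩ := Option.ne_none_iff_exists'.1 hne
      simp [hsome n hb]
    · exact fun h => absurd ho h

/-- There are linear functionals on `F⸨X⸩` over `F(X)` which vanish on `F(X)` and are dual to the
lacunary series. -/
lemma exists_dual_lacunary : ∃ φ : ℕ → (F⸨X⸩ →ₗ[RatFunc F] RatFunc F),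
    (∀ k (c : RatFunc F), φ k (algebraMap _ _ c) = 0) ∧
    ∀ k n, φ k (((lacunarySeries n).map (Int.castRingHom F) : PowerSeries F) : F⸨X⸩) =
      if k = n then 1 else 0 := by
  have hli := linearIndependent_oneAndLacunary F
  choose φ hφ using fun k : ℕ => (Module.Basis.span hli).constr (RatFunc F)
    (fun o => if o = some k then (1 : RatFunc F) else 0) |>.exists_extend
  have key : ∀ k o, φ k (oneAndLacunary F o : F⸨X⸩) = if o = some k then 1 else 0 := by
    intro k o
    have h1 := LinearMap.congr_fun (hφ k) (Module.Basis.span hli o)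
    rw [Module.Basis.constr_basis, LinearMap.comp_apply, Submodule.subtype_apply,
      Module.Basis.span_apply] at h1
    exact h1
  refine ⟨φ, fun k c => ?_, fun k n => ?_⟩
  · rw [Algebra.algebraMap_eq_smul_one, map_smul]
    have := key k none
    simp only [oneAndLacunary, map_one] at this
    simp [this]
  · exact (key k (some n)).trans (by simp [eq_comm])

/-- The element `1 + X` of `F(X)`, as a unit. -/
noncomputable def oneAddX : (RatFunc F)ˣ :=
  Units.mk0 (1 + RatFunc.X) fun h => by
    have : algebraMap (Polynomial F) (RatFunc F) (1 + Polynomial.X) = 0 := by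
      simpa using h
    rw [map_eq_zero_iff _ (RatFunc.algebraMap_injective F)] at this
    simpa [Polynomial.coeff_one] using congrArg (fun p => Polynomial.coeff p 1) this

/-- The ring homomorphism `ℤ[t, t⁻¹] → F(X)` that sends `t` to `1 + X`. -/
noncomputable def laurentToRatFunc : LaurentPolynomial ℤ →+* RatFunc F :=
  LaurentPolynomial.eval₂ (Int.castRingHom _) (oneAddX F)

lemma coe_laurentExpansion (q : LaurentPolynomial ℤ) :
    ((laurentExpansion F q : PowerSeries F) : F⸨X⸩) = algebraMap _ _ (laurentToRatFunc F q) := by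
  have h : (HahnSeries.ofPowerSeries ℤ F).comp (laurentExpansion F) =
      (algebraMap (RatFunc F) F⸨X⸩).comp (laurentToRatFunc F) := by
    refine IsLocalization.ringHom_ext (Submonoid.powers (Polynomial.X : Polynomial ℤ)) ?_
    refine Polynomial.ringHom_ext (fun a => ?_) ?_
    · simp
    · simp [laurentToRatFunc, laurentExpansion, oneAddX]
  exact RingHom.congr_fun h q

/-- The field `F(X)` has an endomorphism that inverts `1 + X`. -/
lemma exists_ringHom_oneAddX_inv :
    ∃ σ : RatFunc F →+* RatFunc F, σ (oneAddX F) = ((oneAddX F)⁻¹ : (RatFunc F)ˣ) := by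
  have ht : Transcendental F (((oneAddX F : RatFunc F))⁻¹ - 1) := by
    intro h
    refine RatFunc.transcendental_X (K := F) ?_
    have h1 : IsAlgebraic F (oneAddX F : RatFunc F) := by
      have := (h.add isAlgebraic_one).inv
      simpa using this
    have h2 := h1.sub isAlgebraic_one
    simpa [oneAddX] using h2
  let φ : Polynomial F →+* RatFunc F :=
    (Polynomial.aeval (((oneAddX F : RatFunc F))⁻¹ - 1)).toRingHom
  have hφ : nonZeroDivisors (Polynomial F) ≤ (nonZeroDivisors (RatFunc F)).comap φ :=
    nonZeroDivisors_le_comap_nonZeroDivisors_of_injective _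
      (transcendental_iff_injective.1 ht)
  refine ⟨RatFunc.liftRingHom φ hφ, ?_⟩
  have h : (oneAddX F : RatFunc F) = algebraMap (Polynomial F) _ (1 + Polynomial.X) := by
    simp [oneAddX]
  rw [h, RatFunc.liftRingHom_algebraMap]
  simp [φ]

end

/-! ### Dual crossed homomorphisms and the rank argument -/

open CompletedLamplighter

section

variable (F : Type) [Field F]

open scoped LaurentSeries RatFunc

/-- The character of the completed lamplighter group with values in `F(X)` that sends `t` to
`1 + X`. -/
noncomputable def shiftCharacter : CompletedLamplighter →* (RatFunc F)ˣ :=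
  (zpowersHom _ (oneAddX F)).comp shift

lemma coe_shiftCharacter (g : CompletedLamplighter) :
    (shiftCharacter F g : RatFunc F) = laurentToRatFunc F (T (shift g).toAdd) := by
  rw [laurentToRatFunc, LaurentPolynomial.eval₂_T]
  rfl

/-- The completed lamplighter group carries crossed homomorphisms `u k`, `v k` to `F(X)`, for the
actions through a character and through its inverse, which are dual to the lacunary series;
moreover, the `u k` vanish on the lamplighter group itself. -/
lemma exists_dual_crossedHom :
    ∃ u v : ℕ → CompletedLamplighter → RatFunc F,
      (∀ k g h, u k (g * h) = u k g + shiftCharacter F g * u k h) ∧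
      (∀ k g h, v k (g * h) = v k g + (shiftCharacter F g)⁻¹ * v k h) ∧
      (∀ k l, u k (toPronilpotentCompletion Lamplighter l) = 0) ∧
      (∀ k n, u k (ofSeries (lacunarySeries n)) = if k = n then 1 else 0) ∧
      (∀ k n, v k (ofSeries (lacunarySeries n)) = if k = n then 1 else 0) := by
  obtain ⟨φ, hφ, hφ'⟩ := exists_dual_lacunary F
  obtain ⟨σ, hσ⟩ := exists_ringHom_oneAddX_inv F
  have hu : ∀ k (g h : CompletedLamplighter), φ k (toSeries F (g * h) : F⸨X⸩) =
      φ k (toSeries F g : F⸨X⸩) + shiftCharacter F g * φ k (toSeries F h : F⸨X⸩) := by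
    intro k g h
    rw [toSeries_mul, map_add, map_mul, coe_laurentExpansion, ← Algebra.smul_def, map_add,
      map_smul, smul_eq_mul, coe_shiftCharacter]
  have hχ : ∀ g, σ (shiftCharacter F g) = ((shiftCharacter F g)⁻¹ : (RatFunc F)ˣ) := by
    intro g
    change σ ((oneAddX F ^ (shift g).toAdd : (RatFunc F)ˣ) : RatFunc F) =
      (((oneAddX F ^ (shift g).toAdd)⁻¹ : (RatFunc F)ˣ) : RatFunc F)
    rw [← inv_zpow, Units.val_zpow_eq_zpow_val, Units.val_zpow_eq_zpow_val, map_zpow₀, hσ]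
  refine ⟨fun k g => φ k (toSeries F g : F⸨X⸩), fun k g => σ (φ k (toSeries F g : F⸨X⸩)),
    hu, fun k g h => ?_, fun k l => ?_, fun k n => ?_, fun k n => ?_⟩
  · simp only [hu, map_add, map_mul, hχ]
  · simp only [toSeries_toPronilpotentCompletion, coe_laurentExpansion, hφ]
  · simp only [toSeries_ofSeries, hφ']
  · simp only [toSeries_ofSeries, hφ']
    split_ifs <;> simp

end

/-- The class of the torus `(f, f') - (f', f)` in the cokernel of `H₂(L) → H₂(L̂)`. -/
noncomputable def torusClass (f f' : PowerSeries ℤ) :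
    (Limits.cokernel (H2map (toPronilpotentCompletion Lamplighter)) : ModuleCat.{0} ℤ) :=
  Limits.cokernel.π (H2map (toPronilpotentCompletion Lamplighter))
    (groupHomology.H2π (Rep.trivial ℤ CompletedLamplighter ℤ)
      ⟨_, single_sub_single_mem_cycles₂ (commute_ofSeries f f')⟩)

/-- A `2`-cycle supported on `r` pairs pairs with a family of cup products of crossed homomorphisms
in a matrix of rank at most `r`. -/
lemma card_le_of_evalChains_cup_eq_diagonal {G K : Type} [Group G] [Field K] (c : G → K)
    {p : ℕ} (u v : Fin p → G → K) (x : G × G →₀ ℤ) (d : Fin p → K) (hd : ∀ k, d k ≠ 0)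
    (h : ∀ k l, evalChains (fun s : G × G => u k s.1 * (c s.1 * v l s.2)) x =
      if k = l then d k else 0) :
    p ≤ x.support.card := by
  let U : Matrix (Fin p) x.support K := Matrix.of fun k s => x s.1 * u k s.1.1
  let V : Matrix x.support (Fin p) K := Matrix.of fun s l => c s.1.1 * v l s.1.2
  have hUV : U * V = Matrix.diagonal d := by
    ext k l
    rw [Matrix.mul_apply, Matrix.diagonal_apply, ← h k l, evalChains,
      Finsupp.linearCombination_apply, Finsupp.sum,
      ← Finset.sum_coe_sort x.support fun s => x s • (u k s.1 * (c s.1 * v l s.2))]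
    refine Finset.sum_congr rfl fun s _ => ?_
    simp only [U, V, Matrix.of_apply, zsmul_eq_mul]
    ring
  have hrank : (Matrix.diagonal d).rank = p := by
    rw [Matrix.rank_of_isUnit, Fintype.card_fin]
    rw [Matrix.isUnit_diagonal, Pi.isUnit_iff]
    exact fun k => (hd k).isUnit
  calc p = (U * V).rank := by rw [hUV, hrank]
    _ ≤ U.rank := Matrix.rank_mul_le_left U V
    _ ≤ Fintype.card x.support := Matrix.rank_le_card_width U
    _ = x.support.card := Fintype.card_coe _

theorem theorem4p4 :
    ¬ IsCotorsion
        (Limits.cokernel (H2map (toPronilpotentCompletion Lamplighter))) := by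
  intro hcot
  obtain ⟨y, hy⟩ := hcot.exists_solution fun n =>
    torusClass (lacunarySeries (2 * n)) (lacunarySeries (2 * n + 1))
  obtain ⟨x, hx⟩ := exists_cycle_of_cokernel _ (y 0)
  obtain ⟨p, hpx, hp⟩ := Nat.exists_infinite_primes (x.1.support.card + 1)
  have : Fact p.Prime := ⟨hp⟩
  obtain ⟨u, v, hu, hv, huL, hus, hvs⟩ := exists_dual_crossedHom (ZMod p)
  let χ := shiftCharacter (ZMod p)
  have hχ : ∀ f : PowerSeries ℤ, χ (ofSeries f) = 1 := fun f => by
    change zpowersHom _ (oneAddX (ZMod p)) (shift (ofSeries f)) = 1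
    rw [shift_ofSeries, map_one]
  choose B hB using fun k l : ℕ =>
    exists_hom_cokernel_of_cocycle (toPronilpotentCompletion Lamplighter)
      (isTrivialCocycle₂_cup χ (hu (2 * k)) (hv (2 * l + 1)))
      fun g h => by simp only [huL, zero_mul]
  have hBtorus : ∀ k l n, B k l (torusClass (lacunarySeries (2 * n)) (lacunarySeries (2 * n + 1))) =
      if k = n ∧ l = n then 1 else 0 := by
    intro k l n
    rw [torusClass, hB, evalChains, map_sub, Finsupp.linearCombination_single,
      Finsupp.linearCombination_single]
    -- By parity, only the summand `(g, h)` of the torus contributes.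
    have h1 : 2 * k ≠ 2 * n + 1 := by omega
    simp [hus, hvs, hχ, h1, and_comm, ← ite_and]
  have hcast : ∀ m : ℕ, (m : RatFunc (ZMod p)) = 0 ↔ p ∣ m := fun m =>
    CharP.cast_eq_zero_iff (RatFunc (ZMod p)) p m
  have hBy : ∀ k l : Fin p, B k l (y 0) =
      if k = l then ((k : ℕ).factorial : RatFunc (ZMod p)) else 0 := by
    intro k l
    -- The remainder term `p! y p` is killed, since the values of `B k l` have characteristic `p`.
    rw [eq_sum_factorial_smul_add hy p, map_add, map_sum, map_zsmul, zsmul_eq_mul, Int.cast_natCast,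
      (hcast _).2 (hp.dvd_factorial.2 le_rfl), zero_mul, add_zero,
      Finset.sum_eq_single_of_mem (k : ℕ) (Finset.mem_range.2 k.2)]
    · rw [map_zsmul, hBtorus]
      simp [Fin.ext_iff, eq_comm]
    · intro n _ hn
      rw [map_zsmul, hBtorus, if_neg fun h => hn h.1.symm, smul_zero]
  have hle := card_le_of_evalChains_cup_eq_diagonal
    (fun g => (((χ g)⁻¹ : (RatFunc (ZMod p))ˣ) : RatFunc (ZMod p)))
    (fun k : Fin p => u (2 * k)) (fun l : Fin p => v (2 * l + 1)) x.1
    (fun k => ((k : ℕ).factorial : RatFunc (ZMod p)))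
    (fun k h => by
      have := hp.dvd_factorial.1 ((hcast _).1 h)
      omega)
    (fun k l => by rw [← hBy, ← hx, hB])
  omega
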